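/- Let $n \ge 0$ be an integer and let $\mathrm{C}^*(\mathbb{F}_n)$ be the full group $\mathrm{C}^*$-algebra of the free group on $n$ generators, i.e. the completion of the group algebra $\mathbb{C}[\mathbb{F}_n]$ in the norm $\|f\| = \sup_\pi \|\pi(f)\|$, where $\pi$ runs over all unitary representations of $\mathbb{F}_n$ on complex Hilbert spaces. Let $A(\mathbb{F}_n^+)$ be the norm-closed unital (non-selfadjoint) subalgebra of $\mathrm{C}^*(\mathbb{F}_n)$ generated by the $n$ unitaries corresponding to the free generators. Let $S : A(\mathbb{F}_n^+) \to A(\mathbb{F}_n^+)$ be a bounded linear map that is an approximately local left multiplier: for every $a \in A(\mathbb{F}_n^+)$ there is a sequence $(x_{a,k})_{k}$ in $A(\mathbb{F}_n^+)$ such that $S(a) = \lim_{k} x_{a,k}\, a$ in norm. Then $S$ is a left multiplier: $S(ab) = S(a)b$ for all $a, b \in A(\mathbb{F}_n^+)$. -/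

import Mathlib

open scoped ENNReal

noncomputable section

universe u

/-- A unitary representation of the (discrete) group `G` on a nonzero complex Hilbert space. The
Hilbert spaces range over the universe of `G`, which contains a unitary copy of every cyclic
representation of `G`; these already determine the universal norm. -/
structure UnitaryRep (G : Type u) [Group G] : Type (u + 1) where
  /-- The Hilbert space of the representation. -/
  H : Type u
  [normed : NormedAddCommGroup H]
  [inner : InnerProductSpace ℂ H]
  [complete : CompleteSpace H]
  [nontriv : Nontrivial H]
  /-- The homomorphism into the unitary group of `B(H)`. -/
  ρ : G →* unitary (H →L[ℂ] H)

attribute [instance] UnitaryRep.normed UnitaryRep.inner UnitaryRep.complete UnitaryRep.nontriv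

/-- The `ℓ^∞`-direct sum of the C*-algebras `B(H_π)`, where `π` runs over all unitary
representations of `G`: bounded families of operators, with the supremum norm. It is the algebra of
block-diagonal operators on the Hilbert space direct sum of all the `H_π`. -/
abbrev UniversalBlock (G : Type u) [Group G] : Type (u + 1) :=
  lp (fun π : UnitaryRep G => π.H →L[ℂ] π.H) ∞

/-- The universal representation `g ↦ (π(g))_π`, the direct sum of all unitary representations. -/
def universalRep {G : Type u} [Group G] (g : G) : UniversalBlock G :=
  ⟨fun π => (π.ρ g : π.H →L[ℂ] π.H), memℓp_infty ⟨1, by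
    rintro _ ⟨π, rfl⟩
    exact (CStarRing.norm_of_mem_unitary (π.ρ g).2).le⟩⟩

instance UniversalBlock.instCStarAlgebra (G : Type u) [Group G] :
    CStarAlgebra (UniversalBlock G) where

/-- The closed star subalgebra of the algebra of block-diagonal operators that is generated by the
image of `G` under the direct sum of all its unitary representations. -/
def fullGroupCStarSubalgebra (G : Type u) [Group G] : StarSubalgebra ℂ (UniversalBlock G) :=
  (StarAlgebra.adjoin ℂ (Set.range (universalRep (G := G)))).topologicalClosure

instance fullGroupCStarSubalgebra.instIsClosed (G : Type u) [Group G] :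
    IsClosed (fullGroupCStarSubalgebra G : Set (UniversalBlock G)) :=
  StarSubalgebra.isClosed_topologicalClosure _

/-- The full group C*-algebra `C*(G)` of a discrete group `G`: the C*-algebra generated by the image
of `G` under the direct sum of all its unitary representations. Equivalently (the norm of a
family is the supremum of the norms of its entries) the completion of the group algebra `ℂ[G]` in
the norm `‖f‖ = sup_π ‖π(f)‖`, the supremum being over all unitary representations `π` of `G`. -/
def FullGroupCStar (G : Type u) [Group G] : Type (u + 1) :=
  fullGroupCStarSubalgebra G

instance FullGroupCStar.instCStarAlgebra (G : Type u) [Group G] :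
    CStarAlgebra (FullGroupCStar G) :=
  inferInstanceAs (CStarAlgebra (fullGroupCStarSubalgebra G))

/-- The canonical unitary of `C*(G)` attached to a group element. -/
def groupUnitary {G : Type u} [Group G] (g : G) : FullGroupCStar G :=
  (⟨universalRep g, StarSubalgebra.le_topologicalClosure _
    (StarAlgebra.subset_adjoin ℂ _ ⟨g, rfl⟩)⟩ : fullGroupCStarSubalgebra G)

/-- The algebra `A(F_n⁺)`: the norm-closed unital, not necessarily selfadjoint, subalgebra of
`C*(F_n)` generated by the `n` unitaries that correspond to the free generators. -/
def freeSemigroupAlgebra (n : ℕ) : Subalgebra ℂ (FullGroupCStar (FreeGroup (Fin n))) :=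
  (Algebra.adjoin ℂ
    (Set.range fun i : Fin n => groupUnitary (FreeGroup.of i))).topologicalClosure

/-- A bounded linear map `S` on a Banach algebra is a left multiplier if `S(ab) = S(a)b`. -/
def IsLeftMultiplier {A : Type*} [NormedRing A] [NormedAlgebra ℂ A] (S : A →L[ℂ] A) : Prop :=
  ∀ a b : A, S (a * b) = S a * b

/-- A bounded linear map `S` on a Banach algebra is an approximately local left multiplier if for
every `a` there is a sequence `x_k` in the algebra, depending on `a`, with `S(a) = lim x_k a`. -/
def IsApproxLocalLeftMultiplier {A : Type*} [NormedRing A] [NormedAlgebra ℂ A]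
    (S : A →L[ℂ] A) : Prop :=
  ∀ a : A, ∃ x : ℕ → A, Filter.Tendsto (fun k => x k * a) Filter.atTop (nhds (S a))

end

noncomputable section

universe u

/-! If `σ` is a finite-dimensional representation, each generator acts as a diagonalizable unitary,
so its image is a combination of idempotents that are polynomials in it, hence images of elements of
the algebra. Approximate locality passes right annihilators through `S` (`map_mul_eq_zero`), which
makes `σ ∘ S` respect right multiplication by such idempotents, then by generators, polynomials and
limits (`eval_map_mul`). Finite-dimensional representations separate points
(`eq_zero_of_forall_finiteDimensional`): finitely many vectors determine a polynomial in the
generators at `ξ`, and isometries between subspaces of a finite-dimensional space extend to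
unitaries. -/

/-! ### Spectral idempotents of finite-dimensional unitaries -/

open Polynomial in
theorem Polynomial.dvd_of_squarefree_of_forall_isRoot {K : Type*} [Field K] [IsAlgClosed K]
    {p f : K[X]} (hp : Squarefree p) (h : ∀ x, p.IsRoot x → f.IsRoot x) : p ∣ f := by
  classical
  rcases eq_or_ne f 0 with rfl | hf
  · exact dvd_zero _
  rw [(IsAlgClosed.splits p).dvd_iff_roots_le_roots hp.ne_zero hf,
    Multiset.le_iff_subset (nodup_roots (PerfectField.separable_iff_squarefree.2 hp))]
  intro x hx
  rw [mem_roots hp.ne_zero] at hx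
  exact (mem_roots hf).2 (h x hx)

open Polynomial in
/-- An element of an algebra annihilated by a squarefree polynomial is a linear combination of
idempotents which are polynomials in it. -/
theorem exists_idempotent_decomposition {K B : Type*} [Field K] [IsAlgClosed K] [Ring B]
    [Algebra K B] (v : B) {p : K[X]} (hp : Squarefree p) (hv : aeval v p = 0) :
    ∃ (s : Finset K) (e : K → K[X]), (∀ c ∈ s, IsIdempotentElem (aeval v (e c))) ∧
      v = ∑ c ∈ s, c • aeval v (e c) := by
  classical
  -- Identities at `v` need only be checked at the roots of `p`, where Lagrange basis polynomials
  -- are indicator functions.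
  have key (f : K[X]) (h : ∀ x, p.IsRoot x → f.IsRoot x) : aeval v f = 0 := by
    obtain ⟨g, rfl⟩ := Polynomial.dvd_of_squarefree_of_forall_isRoot hp h
    simp [hv]
  let s := p.roots.toFinset
  have hs (x : K) : x ∈ s ↔ p.IsRoot x := by simp [s, hp.ne_zero]
  have hb (x : K) (hx : x ∈ s) (c : K) (hc : c ∈ s) :
      (Lagrange.basis s id c).eval x = if x = c then 1 else 0 := by
    split_ifs with h
    · subst h
      exact Lagrange.eval_basis_self (v := id) Function.injective_id.injOn hc
    · exact Lagrange.eval_basis_of_ne (v := id) (Ne.symm h) hx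
  refine ⟨s, fun c => Lagrange.basis s id c, fun c hc => ?_, ?_⟩
  · have := key (Lagrange.basis s id c * Lagrange.basis s id c - Lagrange.basis s id c)
      fun x hx => by
        rw [← hs] at hx
        simp only [IsRoot.def, eval_sub, eval_mul, hb x hx c hc]
        split_ifs <;> simp
    rwa [map_sub, map_mul, sub_eq_zero] at this
  · have := key (X - ∑ c ∈ s, c • Lagrange.basis s id c) fun x hx => by
      rw [← hs] at hx
      simp only [IsRoot.def, eval_sub, eval_X, eval_finsetSum, eval_smul]
      rw [Finset.sum_congr rfl fun c hc => by rw [hb x hx c hc]]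
      simp [hx]
    simpa [sub_eq_zero] using this

/-- A linear isometry of a finite-dimensional complex inner product space is diagonalizable. -/
theorem LinearIsometry.isSemisimple {M : Type*} [NormedAddCommGroup M] [InnerProductSpace ℂ M]
    [FiniteDimensional ℂ M] (V : M →ₗᵢ[ℂ] M) : Module.End.IsSemisimple V.toLinearMap := by
  rw [Module.End.isSemisimple_iff]
  intro p hp
  refine ⟨pᗮ, fun x hx => ?_, p.isCompl_orthogonal⟩
  have hle : p.map V.toLinearMap ≤ p := Submodule.map_le_iff_le_comap.2 hp
  -- By dimension `V` maps `p` onto itself, so every `u ∈ p` is some `V w`, and `⟪V w, V x⟫ = ⟪w, x⟫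
  -- = 0`.
  have heq : p.map V.toLinearMap = p :=
    Submodule.eq_of_le_of_finrank_eq hle
      (Submodule.equivMapOfInjective V.toLinearMap V.injective p).finrank_eq.symm
  rw [Submodule.mem_comap, Submodule.mem_orthogonal]
  intro u hu
  rw [← heq] at hu
  obtain ⟨w, hw, rfl⟩ := hu
  exact (V.inner_map_map w x).trans ((Submodule.mem_orthogonal _ _).1 hx w hw)

/-- A unitary operator on a finite-dimensional Hilbert space is a linear combination of idempotents
which are polynomials in it. -/
theorem exists_idempotent_decomposition_of_unitary {M : Type*} [NormedAddCommGroup M]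
    [InnerProductSpace ℂ M] [CompleteSpace M] [FiniteDimensional ℂ M]
    (U : unitary (M →L[ℂ] M)) :
    ∃ (s : Finset ℂ) (e : ℂ → Polynomial ℂ),
      (∀ c ∈ s, IsIdempotentElem (Polynomial.aeval (U : M →L[ℂ] M) (e c))) ∧
      (U : M →L[ℂ] M) = ∑ c ∈ s, c • Polynomial.aeval (U : M →L[ℂ] M) (e c) := by
  let T : M →ₗ[ℂ] M := ((U : M →L[ℂ] M) : M →ₗ[ℂ] M)
  have hT : Module.End.IsSemisimple T :=
    (Unitary.linearIsometryEquiv U).toLinearIsometry.isSemisimple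
  refine exists_idempotent_decomposition _ hT.minpoly_squarefree ?_
  let F : (M →L[ℂ] M) →ₐ[ℂ] Module.End ℂ M :=
    AlgHom.ofLinearMap (ContinuousLinearMap.coeLM ℂ) rfl fun _ _ => rfl
  have hF : Function.Injective F := ContinuousLinearMap.coe_injective
  apply hF
  rw [map_zero, ← Polynomial.aeval_algHom_apply]
  exact minpoly.aeval ℂ T

/-! ### Approximately local multipliers seen through a homomorphism -/

section Multiplier

variable {A B : Type*} [NormedRing A] [NormedAlgebra ℂ A] [NormedRing B] [NormedAlgebra ℂ B]
  {S : A →L[ℂ] A}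

/-- Every approximant `x k * (a * b)` has an image that kills `c` from the left, and this survives
the limit. -/
theorem IsApproxLocalLeftMultiplier.map_mul_eq_zero (hS : IsApproxLocalLeftMultiplier S)
    (φ : A →ₐ[ℂ] B) (hφ : Continuous φ) (a b : A) {c : B} (h : φ b * c = 0) :
    φ (S (a * b)) * c = 0 := by
  obtain ⟨x, hx⟩ := hS (a * b)
  have h1 := ((hφ.tendsto _).comp hx).mul_const c
  refine tendsto_nhds_unique h1 ?_
  simp [mul_assoc, h]

/-- Both `q` against `1 - φ q` and `1 - q` against `φ q` are annihilating pairs; only the image of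
`q` has to be idempotent. -/
theorem IsApproxLocalLeftMultiplier.map_mul_of_idempotent (hS : IsApproxLocalLeftMultiplier S)
    (φ : A →ₐ[ℂ] B) (hφ : Continuous φ) (a q : A) (hq : IsIdempotentElem (φ q)) :
    φ (S (a * q)) = φ (S a) * φ q := by
  have h1 := hS.map_mul_eq_zero φ hφ a q (c := 1 - φ q) (by rw [mul_sub, hq.eq]; simp)
  have h2 := hS.map_mul_eq_zero φ hφ a (1 - q) (c := φ q)
    (by rw [map_sub, sub_mul, hq.eq]; simp)
  rw [mul_sub, mul_one, map_sub, map_sub, sub_mul, sub_eq_zero] at h2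
  rw [mul_sub, mul_one, sub_eq_zero] at h1
  rw [h1, h2]

theorem IsApproxLocalLeftMultiplier.map_mul_of_sum_idempotent
    (hS : IsApproxLocalLeftMultiplier S) (φ : A →ₐ[ℂ] B) (hφ : Continuous φ) (a u : A)
    (s : Finset ℂ) (e : ℂ → Polynomial ℂ)
    (he : ∀ c ∈ s, IsIdempotentElem (Polynomial.aeval (φ u) (e c)))
    (hu : φ u = ∑ c ∈ s, c • Polynomial.aeval (φ u) (e c)) :
    φ (S (a * u)) = φ (S a) * φ u := by
  let q : ℂ → A := fun c => Polynomial.aeval u (e c)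
  have hq (c : ℂ) : φ (q c) = Polynomial.aeval (φ u) (e c) :=
    (Polynomial.aeval_algHom_apply φ u (e c)).symm
  simp only [← hq] at he hu
  -- With `c = 1`, `φ (S (a * b))` depends on `b` only through `φ b`.
  have h := hS.map_mul_eq_zero φ hφ a (u - ∑ c ∈ s, c • q c) (c := 1)
    (by simp only [map_sub, map_sum, map_smul, mul_one]; rw [← hu, sub_self])
  rw [mul_one, mul_sub, map_sub, map_sub, sub_eq_zero] at h
  rw [h, Finset.mul_sum, map_sum, map_sum]
  conv_rhs => rw [hu]
  rw [Finset.mul_sum]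
  refine Finset.sum_congr rfl fun c hc => ?_
  rw [mul_smul_comm, map_smul, map_smul, hS.map_mul_of_idempotent φ hφ a _ (he c hc),
    mul_smul_comm]

end Multiplier

/-! ### Separation by finite-dimensional representations -/

namespace FullGroupCStar

variable {G : Type u} [Group G]

/-- The extension of a unitary representation of `G` to `C*(G)`. -/
def eval (π : UnitaryRep G) : FullGroupCStar G →ₐ[ℂ] (π.H →L[ℂ] π.H) where
  toFun x := (show fullGroupCStarSubalgebra G from x).1 π
  map_one' := rfl
  map_mul' _ _ := rfl
  map_zero' := rfl
  map_add' _ _ := rfl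
  commutes' _ := rfl

@[simp]
theorem eval_groupUnitary (π : UnitaryRep G) (g : G) :
    eval π (groupUnitary g) = (π.ρ g : π.H →L[ℂ] π.H) :=
  rfl

theorem norm_eval_le (π : UnitaryRep G) (x : FullGroupCStar G) : ‖eval π x‖ ≤ ‖x‖ :=
  lp.norm_apply_le_norm ENNReal.top_ne_zero (show fullGroupCStarSubalgebra G from x).1 π

theorem continuous_eval (π : UnitaryRep G) : Continuous (eval π) :=
  AddMonoidHomClass.continuous_of_bound (eval π) 1 fun x => by
    simpa using norm_eval_le π x

theorem eq_zero_of_forall_eval {x : FullGroupCStar G} (h : ∀ π : UnitaryRep G, eval π x = 0) :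
    x = 0 :=
  Subtype.ext (lp.ext (funext h))

end FullGroupCStar

open FullGroupCStar

theorem exists_linearIsometry_extend {H : Type*} [NormedAddCommGroup H] [InnerProductSpace ℂ H]
    {ι : Type*} (U : ι → H →ₗᵢ[ℂ] H) (N M : Submodule ℂ H) [FiniteDimensional ℂ M]
    (hU : ∀ i, ∀ x ∈ N, U i x ∈ M) :
    ∃ V : ι → M →ₗᵢ[ℂ] M, ∀ i (x : M), (x : H) ∈ N → (V i x : H) = U i x := by
  let S : Submodule ℂ M := N.comap M.subtype
  let L (i : ι) : S →ₗᵢ[ℂ] M :=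
    { toLinearMap := ((U i).toLinearMap ∘ₗ M.subtype ∘ₗ S.subtype).codRestrict M
        fun x => hU i _ x.2
      norm_map' := fun x => (U i).norm_map _ }
  refine ⟨fun i => (L i).extend, fun i x hx => ?_⟩
  rw [(L i).extend_apply ⟨x, hx⟩]
  rfl

namespace UnitaryRep

variable {ι : Type u}

/-- A representation of the free group given by isometries of a finite-dimensional space. -/
def ofIsometries {M : Type u} [NormedAddCommGroup M] [InnerProductSpace ℂ M]
    [FiniteDimensional ℂ M] [CompleteSpace M] [Nontrivial M] (V : ι → M →ₗᵢ[ℂ] M) :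
    UnitaryRep (FreeGroup ι) where
  H := M
  ρ := FreeGroup.lift fun i =>
    Unitary.linearIsometryEquiv.symm ((V i).toLinearIsometryEquiv rfl)

/-- Finitely many vectors do not distinguish a unitary representation of a free group, as far as
the generators are concerned, from a finite-dimensional one. -/
theorem exists_finiteDimensional_agree [Finite ι] (π : UnitaryRep (FreeGroup ι)) {ξ : π.H}
    (hξ : ξ ≠ 0) (N : Submodule ℂ π.H) [FiniteDimensional ℂ N] :
    ∃ (σ : UnitaryRep (FreeGroup ι)) (_ : FiniteDimensional ℂ σ.H) (J : σ.H →ₗᵢ[ℂ] π.H),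
      (∃ η, J η = ξ) ∧ ∀ i x, J x ∈ N →
        J ((σ.ρ (FreeGroup.of i) : σ.H →L[ℂ] σ.H) x) =
          (π.ρ (FreeGroup.of i) : π.H →L[ℂ] π.H) (J x) := by
  let U (i : ι) : π.H →ₗᵢ[ℂ] π.H :=
    (Unitary.linearIsometryEquiv (π.ρ (FreeGroup.of i))).toLinearIsometry
  -- `M` need not contain `N`: each `U i` maps `N ⊓ M` isometrically into `M`, and that partial
  -- isometry extends to `M`.
  let M : Submodule ℂ π.H := Submodule.span ℂ {ξ} ⊔ ⨆ i, N.map (U i).toLinearMap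
  have hξM : ξ ∈ M := Submodule.mem_sup_left (Submodule.mem_span_singleton_self ξ)
  have : Nontrivial M := ⟨⟨ξ, hξM⟩, 0, fun h => hξ (congrArg Subtype.val h)⟩
  have : CompleteSpace M := FiniteDimensional.complete ℂ M
  obtain ⟨V, hV⟩ := exists_linearIsometry_extend U N M fun i x hx =>
    Submodule.mem_sup_right (Submodule.mem_iSup_of_mem i (Submodule.mem_map_of_mem hx))
  refine ⟨ofIsometries V, inferInstanceAs (FiniteDimensional ℂ M), M.subtypeₗᵢ, ⟨⟨ξ, hξM⟩, rfl⟩,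
    fun i x hx => ?_⟩
  have h : ((ofIsometries V).ρ (FreeGroup.of i)) =
      Unitary.linearIsometryEquiv.symm ((V i).toLinearIsometryEquiv rfl) :=
    FreeGroup.lift_apply_of
  rw [h]
  exact hV i x hx

/-- The action of a polynomial in the free generators on a vector is determined by the action of
the generators on a finite-dimensional subspace. -/
theorem exists_subspace_determining (π : UnitaryRep (FreeGroup ι))
    {p : FullGroupCStar (FreeGroup ι)}
    (hp : p ∈ Algebra.adjoin ℂ (Set.range fun i : ι => groupUnitary (FreeGroup.of i)))
    (ξ : π.H) :
    ∃ (N : Submodule ℂ π.H) (_ : FiniteDimensional ℂ N), ∀ (σ : UnitaryRep (FreeGroup ι))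
      (J : σ.H →ₗᵢ[ℂ] π.H), (∀ i x, J x ∈ N →
        J ((σ.ρ (FreeGroup.of i) : σ.H →L[ℂ] σ.H) x) =
          (π.ρ (FreeGroup.of i) : π.H →L[ℂ] π.H) (J x)) →
      ∀ η, J η = ξ → J (eval σ p η) = eval π p ξ := by
  induction hp using Algebra.adjoin_induction generalizing ξ with
  | mem x hx =>
    obtain ⟨i, rfl⟩ := hx
    refine ⟨Submodule.span ℂ {ξ}, inferInstance, ?_⟩
    rintro σ J h η rfl
    exact h i η (Submodule.mem_span_singleton_self _)
  | algebraMap r =>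
    refine ⟨⊥, inferInstance, ?_⟩
    rintro σ J - η rfl
    rw [AlgHom.commutes, AlgHom.commutes]
    exact J.map_smul r η
  | add p q _ _ ihp ihq =>
    obtain ⟨N, _, hN⟩ := ihp ξ
    obtain ⟨N', _, hN'⟩ := ihq ξ
    refine ⟨N ⊔ N', inferInstance, fun σ J h η hη => ?_⟩
    rw [map_add, map_add, add_apply, add_apply, map_add,
      hN σ J (fun i x hx => h i x (Submodule.mem_sup_left hx)) η hη,
      hN' σ J (fun i x hx => h i x (Submodule.mem_sup_right hx)) η hη]
  | mul p q _ _ ihp ihq =>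
    obtain ⟨N', _, hN'⟩ := ihq ξ
    obtain ⟨N, _, hN⟩ := ihp (eval π q ξ)
    refine ⟨N ⊔ N', inferInstance, fun σ J h η hη => ?_⟩
    rw [map_mul, map_mul, mul_apply_eq_comp, mul_apply_eq_comp]
    exact hN σ J (fun i x hx => h i x (Submodule.mem_sup_left hx)) _
      (hN' σ J (fun i x hx => h i x (Submodule.mem_sup_right hx)) η hη)

end UnitaryRep

/-- The finite-dimensional unitary representations of the free group separate the points of
`A(F_n⁺)`. -/
theorem freeSemigroupAlgebra.eq_zero_of_forall_finiteDimensional {n : ℕ}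
    {y : FullGroupCStar (FreeGroup (Fin n))} (hy : y ∈ freeSemigroupAlgebra n)
    (h : ∀ σ : UnitaryRep (FreeGroup (Fin n)), FiniteDimensional ℂ σ.H → eval σ y = 0) :
    y = 0 := by
  refine eq_zero_of_forall_eval fun π => ?_
  ext ξ
  rcases eq_or_ne ξ 0 with rfl | hξ
  · simp
  rw [zero_apply, ← norm_le_zero_iff]
  refine le_of_forall_pos_le_add fun ε hε => ?_
  have hδ : 0 < ε / (2 * ‖ξ‖) := by positivity
  obtain ⟨p, hp, hyp⟩ := Metric.mem_closure_iff.1 hy _ hδ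
  rw [dist_eq_norm] at hyp
  obtain ⟨N, _, hN⟩ := π.exists_subspace_determining hp ξ
  obtain ⟨σ, hσ, J, ⟨η, hη⟩, hJ⟩ := π.exists_finiteDimensional_agree hξ N
  have h1 : ‖eval π p ξ‖ ≤ ‖y - p‖ * ‖ξ‖ := by
    rw [← hN σ J hJ η hη, J.norm_map, ← hη, J.norm_map]
    -- As `σ` kills `y`, it makes `p` as small as `y - p`; `J` carries this bound to `π` at `ξ`.
    have h3 : eval σ p = - eval σ (y - p) := by rw [map_sub, h σ hσ]; simp
    rw [h3, neg_apply, norm_neg]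
    exact (eval σ (y - p)).le_of_opNorm_le (norm_eval_le _ _) η
  have h2 : ‖eval π (y - p) ξ‖ ≤ ‖y - p‖ * ‖ξ‖ :=
    (eval π (y - p)).le_of_opNorm_le (norm_eval_le _ _) ξ
  calc ‖eval π y ξ‖ = ‖eval π (y - p) ξ + eval π p ξ‖ := by
        rw [map_sub, sub_apply, sub_add_cancel]
    _ ≤ ‖y - p‖ * ‖ξ‖ + ‖y - p‖ * ‖ξ‖ := norm_add_le_of_le h2 h1
    _ ≤ ε / (2 * ‖ξ‖) * ‖ξ‖ + ε / (2 * ‖ξ‖) * ‖ξ‖ := by gcongr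
    _ = 0 + ε := by field_simp; ring

/-! ### The multiplier identity -/

theorem IsApproxLocalLeftMultiplier.eval_map_mul {n : ℕ}
    {S : freeSemigroupAlgebra n →L[ℂ] freeSemigroupAlgebra n}
    (hS : IsApproxLocalLeftMultiplier (A := freeSemigroupAlgebra n) S)
    (σ : UnitaryRep (FreeGroup (Fin n))) [FiniteDimensional ℂ σ.H]
    (a b : freeSemigroupAlgebra n) :
    eval σ (S (a * b)) = eval σ (S a) * eval σ b := by
  let φ : freeSemigroupAlgebra n →ₐ[ℂ] (σ.H →L[ℂ] σ.H) :=
    (eval σ).comp (freeSemigroupAlgebra n).val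
  have hφ : Continuous φ := (continuous_eval σ).comp continuous_subtype_val
  -- The right factors that satisfy the identity for all `a` form a subalgebra.
  have poly (p : FullGroupCStar (FreeGroup (Fin n)))
      (hp : p ∈ Algebra.adjoin ℂ
        (Set.range fun i : Fin n => groupUnitary (FreeGroup.of i))) :
      ∃ q : freeSemigroupAlgebra n, (q : FullGroupCStar (FreeGroup (Fin n))) = p ∧
        ∀ a, φ (S (a * q)) = φ (S a) * φ q := by
    induction hp using Algebra.adjoin_induction with
    | mem x hx =>
      obtain ⟨i, rfl⟩ := hx
      obtain ⟨s, e, he, hu⟩ :=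
        exists_idempotent_decomposition_of_unitary (σ.ρ (FreeGroup.of i))
      exact ⟨⟨_, Subalgebra.le_topologicalClosure _ (Algebra.subset_adjoin ⟨i, rfl⟩)⟩, rfl,
        fun a => hS.map_mul_of_sum_idempotent φ hφ a _ s e he hu⟩
    | algebraMap r =>
      refine ⟨algebraMap ℂ _ r, rfl, fun a => ?_⟩
      simp only [Algebra.algebraMap_eq_smul_one, mul_smul_comm, mul_one, map_smul, map_one]
    | add p q _ _ ihp ihq =>
      obtain ⟨p, rfl, hp⟩ := ihp
      obtain ⟨q, rfl, hq⟩ := ihq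
      exact ⟨p + q, rfl, fun a => by simp only [mul_add, map_add, hp, hq]⟩
    | mul p q _ _ ihp ihq =>
      obtain ⟨p, rfl, hp⟩ := ihp
      obtain ⟨q, rfl, hq⟩ := ihq
      exact ⟨p * q, rfl, fun a => by rw [← mul_assoc, hq, hp, map_mul, mul_assoc]⟩
  obtain ⟨p, hp, hpb⟩ := mem_closure_iff_seq_limit.1 b.2
  choose q hqp hq using fun k => poly (p k) (hp k)
  have hqb : Filter.Tendsto q Filter.atTop (nhds b) := by
    rw [tendsto_subtype_rng]
    simpa only [hqp] using hpb
  have h1 := (hφ.tendsto _).comp ((S.continuous.tendsto _).comp (hqb.const_mul a))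
  have h2 := ((hφ.tendsto _).comp hqb).const_mul (φ (S a))
  exact tendsto_nhds_unique (h1.congr fun k => hq k a) h2

end

theorem corollary3p6 (n : ℕ) (S : freeSemigroupAlgebra n →L[ℂ] freeSemigroupAlgebra n)
    (hS : IsApproxLocalLeftMultiplier (A := freeSemigroupAlgebra n) S) :
    IsLeftMultiplier (A := freeSemigroupAlgebra n) S := by
  intro a b
  rw [← sub_eq_zero]
  refine Subtype.ext (freeSemigroupAlgebra.eq_zero_of_forall_finiteDimensional
    (S (a * b) - S a * b).2 fun σ _ => ?_)
  rw [AddSubgroupClass.coe_sub, map_sub (FullGroupCStar.eval σ),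
    hS.eval_map_mul σ a b, sub_eq_zero]
  exact (map_mul (FullGroupCStar.eval σ) _ _).symm
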